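/- Fix reals $0<c<a$ and $\lambda\in\{0,1\}$. For $j\ge 0$ let $\Pi_j$ be the total profit of $j$ of the $j+1$ firms in the Cournot equilibrium of a market with $j+1$ identical firms, inverse demand $P=\max\{a-Q,0\}$ and marginal cost $c$; let ${m\brace j}$ be the Stirling numbers of the second kind, and let $$f^\lambda_m(j)=\frac{e^{\lambda\Pi_j}{m\brace j}}{\sum_{i=0}^{m}e^{\lambda\Pi_i}{m\brace i}},\qquad 0\le j\le m,$$ be the probability that $m$ outsiders form $j$ coalitions ($\lambda=0$: uniform over partitions; $\lambda=1$: logit). For $n\ge 1$ let $N=\{1,\dots,n\}$ be the set of firms. For a non-empty coalition $S\subseteq N$ put $m=n-|S|$. Coalition $S$ chooses a quantity $q_S\ge 0$ and, for each $j\le m$, the $j$ outside coalitions choose quantities $q_1^j,\dots,q_j^j\ge 0$. Coalition $S$ maximizes $\sum_{j=0}^{m}f^\lambda_m(j)\,(a-q_S-\sum_{i=1}^j q^j_i-c)\,q_S$ over $q_S\ge0$, and simultaneously, for every $j$ and $i\le j$, the $i$-th outside coalition maximizes $(a-q_S-\sum_{r=1}^j q^j_r-c)\,q^j_i$ over $q_i^j\ge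 0$. Let $v(S)$ be the expected profit of $S$ in the unique equilibrium of this quantity game, and let $v(\emptyset)=0$. The core of $(N,v)$ is the set of $x\in\mathbb R^n$ with $\sum_{i\in N}x_i=v(N)$ and $\sum_{i\in S}x_i\ge v(S)$ for all $S\subseteq N$. **Proposition 1.** There is $n_0=n_0(a,c,\lambda)$ such that for every $n\ge n_0$ the core of $(N,v)$ is non-empty. Moreover, if $\lambda=0$, or if $\lambda=1$ and $a-c=1$, then the core of $(N,v)$ is non-empty for every $n\ge 11$. -/

import Mathlib

namespace CournotGame

/-! ### The Cournot market with `k` firms -/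

/-- Inverse demand `P = max {a - Q, 0}`. -/
noncomputable def price (a Q : ℝ) : ℝ := max (a - Q) 0

/-- Profit of firm `i` in a market with `k` firms, marginal cost `c` and quantities `q`. -/
noncomputable def firmProfit (a c : ℝ) {k : ℕ} (q : Fin k → ℝ) (i : Fin k) : ℝ :=
  (price a (∑ l, q l) - c) * q i

/-- Cournot–Nash equilibrium among `k` firms choosing non-negative quantities. -/
def IsCournotEquilibrium (a c : ℝ) {k : ℕ} (q : Fin k → ℝ) : Prop :=
  (∀ i, 0 ≤ q i) ∧
    ∀ i, ∀ x : ℝ, 0 ≤ x → firmProfit a c (Function.update q i x) i ≤ firmProfit a c q i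

/-- The Cournot equilibrium of the `k`-firm market
(exists and is unique: `isCournotEquilibrium_iff`). -/
noncomputable def cournotEquilibrium (a c : ℝ) (k : ℕ) : Fin k → ℝ :=
  Classical.epsilon fun q : Fin k → ℝ => IsCournotEquilibrium a c q

/-- `Π_j`: total profit that `j` firms earn in the Cournot market with `j + 1` competing firms
(the remaining firm, the deviant coalition, has the last index). -/
noncomputable def outsidersProfit (a c : ℝ) (j : ℕ) : ℝ :=
  ∑ i : Fin j, firmProfit a c (cournotEquilibrium a c (j + 1)) i.castSucc

/-! ### Beliefs about the outsiders -/

/-- `exp (lam * Π_j) * K_{m,j}` with `K_{m,j}` the Stirling number of the second kind. -/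
noncomputable def weight (a c lam : ℝ) (m j : ℕ) : ℝ :=
  Real.exp (lam * outsidersProfit a c j) * (Nat.stirlingSecond m j : ℝ)

/-- Probability that `m` outsiders form exactly `j` coalitions; `lam = 0` is the uniform model,
`lam = 1` the logit model. For `m ≥ 1` the value `j = 0` has probability `0`; for `m = 0`
it has probability `1`. -/
noncomputable def belief (a c lam : ℝ) (m j : ℕ) : ℝ :=
  weight a c lam m j / ∑ i ∈ Finset.range (m + 1), weight a c lam m i

/-! ### The quantity game played by a deviant coalition facing `m` outsiders -/

/-- `own` is the quantity of the deviant coalition; `out j i` is the quantity of the `i`-th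
outside coalition when the outsiders have formed `j` coalitions. -/
@[ext]
structure Profile (m : ℕ) where
  own : ℝ
  out : (j : Fin (m + 1)) → Fin (j : ℕ) → ℝ

/-- Expected profit of the deviant coalition at quantity `x`, against the outsiders'
quantities `out`, under the probabilities `f` for the number of outside coalitions. -/
noncomputable def ownProfit (a c : ℝ) {m : ℕ} (f : ℕ → ℝ)
    (out : (j : Fin (m + 1)) → Fin (j : ℕ) → ℝ) (x : ℝ) : ℝ :=
  ∑ j : Fin (m + 1), f j * ((a - x - ∑ i, out j i - c) * x)

/-- Profit of the `i`-th of `j` outside coalitions with quantities `y`, the deviant coalition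
producing `x`. -/
noncomputable def outProfit (a c x : ℝ) {j : ℕ} (y : Fin j → ℝ) (i : Fin j) : ℝ :=
  (a - x - ∑ r, y r - c) * y i

/-- Simultaneous maximization by the deviant coalition and by every outside coalition in
every structure, over non-negative quantities. -/
def IsEquilibrium (a c : ℝ) {m : ℕ} (f : ℕ → ℝ) (p : Profile m) : Prop :=
  0 ≤ p.own ∧ (∀ j i, 0 ≤ p.out j i) ∧
    (∀ x : ℝ, 0 ≤ x → ownProfit a c f p.out x ≤ ownProfit a c f p.out p.own) ∧
    ∀ j i, ∀ x : ℝ, 0 ≤ x →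
      outProfit a c p.own (Function.update (p.out j) i x) i ≤ outProfit a c p.own (p.out j) i

instance (m : ℕ) : Nonempty (Profile m) := ⟨⟨0, fun _ _ => 0⟩⟩

/-- The equilibrium of the quantity game with `m` outsiders
(exists and is unique: `isEquilibrium_belief_iff`). -/
noncomputable def equilibrium (a c lam : ℝ) (m : ℕ) : Profile m :=
  Classical.epsilon fun p : Profile m => IsEquilibrium a c (belief a c lam m) p

/-! ### The cooperative game and its core -/

/-- The characteristic function: a non-empty coalition `S` is worth its expected profit in the
equilibrium of the quantity game against the `n - |S|` outsiders. -/
noncomputable def value (a c lam : ℝ) (n : ℕ) (S : Finset (Fin n)) : ℝ :=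
  if S = ∅ then 0
  else ownProfit a c (belief a c lam (n - S.card)) (equilibrium a c lam (n - S.card)).out
    (equilibrium a c lam (n - S.card)).own

/-- The core of a transferable utility game on `Fin n`. -/
def core {n : ℕ} (v : Finset (Fin n) → ℝ) : Set (Fin n → ℝ) :=
  {x | ∑ i, x i = v Finset.univ ∧ ∀ S : Finset (Fin n), v S ≤ ∑ i ∈ S, x i}

/-! ### Well-definedness: the equilibria above exist and are unique -/

lemma isMax_quadratic_iff {A y : ℝ} (hy : 0 ≤ y) :
    (∀ x : ℝ, 0 ≤ x → (A - x) * x ≤ (A - y) * y) ↔ y = max (A / 2) 0 := by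
  constructor
  · intro h
    rcases le_total A 0 with hA | hA
    · have := h 0 le_rfl
      rw [max_eq_right (by linarith)]
      nlinarith
    · have := h (A / 2) (by linarith)
      rw [max_eq_left (by linarith)]
      have : (y - A / 2) ^ 2 ≤ 0 := by nlinarith
      have := pow_eq_zero_iff (two_ne_zero) |>.1 (le_antisymm this (sq_nonneg _))
      linarith
  · intro h x hx
    rcases le_total A 0 with hA | hA
    · rw [max_eq_right (by linarith)] at h
      subst h
      nlinarith
    · rw [max_eq_left (by linarith)] at h
      subst h
      nlinarith [sq_nonneg (x - A / 2)]

lemma isMax_truncated_iff {a c R y : ℝ} (hc : 0 < c) (hy : 0 ≤ y) :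
    (∀ x : ℝ, 0 ≤ x → (max (a - (R + x)) 0 - c) * x ≤ (max (a - (R + y)) 0 - c) * y) ↔
      y = max ((a - c - R) / 2) 0 := by
  have key : ∀ x : ℝ, 0 ≤ x → (a - c - R - x) * x ≤ (max (a - (R + x)) 0 - c) * x := by
    intro x hx
    refine mul_le_mul_of_nonneg_right ?_ hx
    linarith [le_max_left (a - (R + x)) 0]
  have ub : ∀ x : ℝ, 0 ≤ x → (max (a - (R + x)) 0 - c) * x ≤
      (a - c - R - max ((a - c - R) / 2) 0) * max ((a - c - R) / 2) 0 := by
    intro x hx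
    have h1 := (isMax_quadratic_iff (A := a - c - R) (le_max_right _ 0)).2 rfl
    rcases le_total (a - (R + x)) 0 with h | h
    · rw [max_eq_right h]
      have := h1 0 le_rfl
      nlinarith
    · rw [max_eq_left h]
      have := h1 x hx
      linarith
  have hm : (0 : ℝ) ≤ max ((a - c - R) / 2) 0 := le_max_right _ _
  constructor
  · intro h
    have h2 := (key _ hm).trans (h _ hm)
    rcases le_total (a - (R + y)) 0 with h3 | h3
    · rw [max_eq_right h3] at h2
      have h1 := (isMax_quadratic_iff (A := a - c - R) hm).2 rfl 0 le_rfl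
      have hy0 : y = 0 := by nlinarith
      subst hy0
      rw [max_eq_right]
      linarith
    · refine (isMax_quadratic_iff hy).1 fun x hx => ?_
      have := (key x hx).trans (h x hx)
      rw [max_eq_left h3] at this
      linarith
  · intro h x hx
    refine (ub x hx).trans ?_
    rw [← h]
    exact key y hy

/-- Mutual best replies on a residual demand `D`. -/
lemma bestReplies_iff {k : ℕ} {D : ℝ} {y : Fin k → ℝ} :
    (∀ i, y i = max ((D - (∑ l, y l - y i)) / 2) 0) ↔ ∀ i, y i = max D 0 / (k + 1) := by
  have hk : (0 : ℝ) < (k : ℝ) + 1 := by positivity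
  constructor
  · intro h i
    have hy : ∀ i, 0 ≤ y i := fun i => (h i).symm ▸ le_max_right _ _
    have hall : ∀ i, y i = max (D - ∑ l, y l) 0 := by
      intro i
      have h1 := h i
      rcases le_total (D - (∑ l, y l - y i)) 0 with h2 | h2
      · rw [max_eq_right (by linarith)] at h1
        rw [max_eq_right (by linarith), h1]
      · rw [max_eq_left (by linarith)] at h1
        rw [max_eq_left (by linarith [hy i])]
        linarith
    have hsum : ∑ l, y l = k * max (D - ∑ l, y l) 0 := by
      conv_lhs => rw [Finset.sum_congr rfl fun i _ => hall i]
      simp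
    rw [hall i]
    rcases le_total (D - ∑ l, y l) 0 with h2 | h2
    · rw [max_eq_right h2] at hsum ⊢
      rw [max_eq_right (by linarith)]
      simp
    · rw [max_eq_left h2] at hsum ⊢
      have : 0 ≤ D := by
        have : 0 ≤ ∑ l, y l := Finset.sum_nonneg fun i _ => hy i
        linarith
      rw [max_eq_left this, eq_div_iff hk.ne']
      linarith
  · intro h i
    have hsum : ∑ l, y l = k * (max D 0 / (k + 1)) := by
      rw [Finset.sum_congr rfl fun i _ => h i]
      simp
    have hk1 : (1 : ℝ) ≤ k := by exact_mod_cast (Nat.one_le_iff_ne_zero.2 (Fin.pos i).ne')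
    rw [hsum, h i]
    rcases le_total D 0 with hD | hD
    · rw [max_eq_right hD, max_eq_right] <;> simp
      linarith
    · rw [max_eq_left hD]
      have : (D - (k * (D / (k + 1)) - D / (k + 1))) / 2 = D / ((k : ℝ) + 1) := by
        field_simp
        ring
      rw [this, max_eq_left]
      positivity

lemma sum_update_eq {k : ℕ} (q : Fin k → ℝ) (i : Fin k) (x : ℝ) :
    ∑ l, Function.update q i x l = (∑ l, q l - q i) + x := by
  rw [Finset.sum_update_of_mem (Finset.mem_univ i),
    ← Finset.add_sum_erase _ q (Finset.mem_univ i), Finset.sdiff_singleton_eq_erase]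
  ring

theorem isCournotEquilibrium_iff {a c : ℝ} (hc : 0 < c) (hca : c < a) {k : ℕ}
    (q : Fin k → ℝ) :
    IsCournotEquilibrium a c q ↔ q = fun _ => (a - c) / (k + 1) := by
  have hd : max (a - c) 0 = a - c := max_eq_left (by linarith)
  have step : IsCournotEquilibrium a c q ↔
      ∀ i, q i = max ((a - c - (∑ l, q l - q i)) / 2) 0 := by
    have aux : ∀ i, 0 ≤ q i → ((∀ x : ℝ, 0 ≤ x →
        firmProfit a c (Function.update q i x) i ≤ firmProfit a c q i) ↔
        q i = max ((a - c - (∑ l, q l - q i)) / 2) 0) := by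
      intro i hi
      rw [← isMax_truncated_iff hc hi]
      simp only [firmProfit, price, sum_update_eq, Function.update_self, sub_add_cancel]
    constructor
    · rintro ⟨h0, h⟩ i
      exact (aux i (h0 i)).1 (h i)
    · intro h
      have h0 : ∀ i, 0 ≤ q i := fun i => (h i).symm ▸ le_max_right _ _
      exact ⟨h0, fun i => (aux i (h0 i)).2 (h i)⟩
  rw [step, bestReplies_iff, hd, funext_iff]

theorem cournotEquilibrium_eq {a c : ℝ} (hc : 0 < c) (hca : c < a) (k : ℕ) :
    cournotEquilibrium a c k = fun _ => (a - c) / (k + 1) := by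
  have h := Classical.epsilon_spec
    (p := fun q : Fin k → ℝ => IsCournotEquilibrium a c q)
    ⟨_, (isCournotEquilibrium_iff hc hca _).2 rfl⟩
  exact (isCournotEquilibrium_iff hc hca _).1 h

theorem outsidersProfit_eq {a c : ℝ} (hc : 0 < c) (hca : c < a) (j : ℕ) :
    outsidersProfit a c j = j * ((a - c) / (j + 2)) ^ 2 := by
  have hj : (0 : ℝ) < (j : ℝ) + 2 := by positivity
  have h : a - (j + 1) * ((a - c) / ((j : ℝ) + 1 + 1)) = c + (a - c) / (j + 2) := by
    field_simp
    ring
  have h2 : 0 ≤ c + (a - c) / ((j : ℝ) + 2) := by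
    have : 0 ≤ (a - c) / ((j : ℝ) + 2) := div_nonneg (by linarith) hj.le
    linarith
  simp only [outsidersProfit, firmProfit, price, cournotEquilibrium_eq hc hca]
  simp only [Finset.sum_const, Finset.card_univ, Fintype.card_fin, nsmul_eq_mul, Nat.cast_add,
    Nat.cast_one]
  rw [h, max_eq_left h2]
  ring

lemma weight_nonneg (a c lam : ℝ) (m j : ℕ) : 0 ≤ weight a c lam m j := by
  unfold weight
  positivity

lemma sum_weight_pos (a c lam : ℝ) (m : ℕ) :
    0 < ∑ i ∈ Finset.range (m + 1), weight a c lam m i := by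
  refine Finset.sum_pos' (fun i _ => weight_nonneg a c lam m i) ⟨m, by simp, ?_⟩
  simp only [weight, Nat.stirlingSecond_self]
  positivity

lemma belief_nonneg (a c lam : ℝ) (m j : ℕ) : 0 ≤ belief a c lam m j :=
  div_nonneg (weight_nonneg ..) (sum_weight_pos ..).le

lemma sum_belief (a c lam : ℝ) (m : ℕ) : ∑ j : Fin (m + 1), belief a c lam m j = 1 := by
  rw [Fin.sum_univ_eq_sum_range (fun j => belief a c lam m j)]
  simp only [belief]
  rw [← Finset.sum_div, div_self (sum_weight_pos a c lam m).ne']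

/-- `h = ∑ f(j) / (j + 1)`, so that `F = 1 - h`. -/
noncomputable def harm (f : ℕ → ℝ) (m : ℕ) : ℝ := ∑ j : Fin (m + 1), f j / ((j : ℕ) + 1)

theorem isEquilibrium_iff {a c : ℝ} (hca : c < a) {m : ℕ} {f : ℕ → ℝ}
    (hf : ∀ j, 0 ≤ f j) (hsum : ∑ j : Fin (m + 1), f j = 1) (p : Profile m) :
    IsEquilibrium a c f p ↔
      p = ⟨harm f m / (1 + harm f m) * (a - c),
        fun j _ => (a - c) / (((j : ℕ) + 1) * (1 + harm f m))⟩ := by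
  have hpos : 0 < harm f m := by
    have h0 : ∀ j : Fin (m + 1), f j / ((m : ℝ) + 1) ≤ f j / (((j : ℕ) : ℝ) + 1) := by
      intro j
      have : ((j : ℕ) : ℝ) ≤ m := by exact_mod_cast Nat.lt_succ_iff.1 j.2
      exact div_le_div_of_nonneg_left (hf j) (by positivity) (by linarith)
    have h1 := Finset.sum_le_sum fun j (_ : j ∈ Finset.univ) => h0 j
    rw [← Finset.sum_div, hsum] at h1
    exact lt_of_lt_of_le (by positivity) h1
  have hown : ∀ (out : (j : Fin (m + 1)) → Fin (j : ℕ) → ℝ) (x : ℝ),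
      ownProfit a c f out x =
        ((a - c - ∑ j : Fin (m + 1), f j * ∑ i, out j i) - x) * x := by
    intro out x
    have h1 : ∀ j : Fin (m + 1), f j * ((a - x - ∑ i, out j i - c) * x) =
        f j * ((a - c - x) * x) - (f j * ∑ i, out j i) * x := fun j => by ring
    simp only [ownProfit, h1, Finset.sum_sub_distrib, ← Finset.sum_mul, hsum]
    ring
  have hout : ∀ (x : ℝ) {k : ℕ} (y : Fin k → ℝ),
      ((∀ i, 0 ≤ y i) ∧ ∀ i, ∀ z : ℝ, 0 ≤ z →
        outProfit a c x (Function.update y i z) i ≤ outProfit a c x y i) ↔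
      ∀ i, y i = max (a - c - x) 0 / (k + 1) := by
    intro x k y
    rw [← bestReplies_iff]
    have aux : ∀ i, 0 ≤ y i → ((∀ z : ℝ, 0 ≤ z →
        outProfit a c x (Function.update y i z) i ≤ outProfit a c x y i) ↔
        y i = max ((a - c - x - (∑ l, y l - y i)) / 2) 0) := by
      intro i hi
      rw [← isMax_quadratic_iff hi]
      refine forall₂_congr fun z _ => ?_
      have e1 : outProfit a c x (Function.update y i z) i =
          (a - c - x - (∑ l, y l - y i) - z) * z := by
        simp only [outProfit, sum_update_eq, Function.update_self]
        ring
      have e2 : outProfit a c x y i = (a - c - x - (∑ l, y l - y i) - y i) * y i := by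
        simp only [outProfit]
        ring
      rw [e1, e2]
    constructor
    · rintro ⟨h0, h⟩ i
      exact (aux i (h0 i)).1 (h i)
    · intro h
      have h0 : ∀ i, 0 ≤ y i := fun i => (h i).symm ▸ le_max_right _ _
      exact ⟨h0, fun i => (aux i (h0 i)).2 (h i)⟩
  have hexp : ∀ (E : ℝ) (out : (j : Fin (m + 1)) → Fin (j : ℕ) → ℝ),
      (∀ j i, out j i = E / (((j : ℕ) : ℝ) + 1)) →
        ∑ j : Fin (m + 1), f j * ∑ i, out j i = E * (1 - harm f m) := by
    intro E out h
    have h1 : ∀ j : Fin (m + 1), f j * ∑ i, out j i =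
        E * f j - E * (f j / (((j : ℕ) : ℝ) + 1)) := by
      intro j
      rw [Finset.sum_congr rfl fun i _ => h j i]
      simp only [Finset.sum_const, Finset.card_univ, Fintype.card_fin, nsmul_eq_mul]
      have : ((j : ℕ) : ℝ) + 1 ≠ 0 := by positivity
      field_simp
      ring
    simp only [h1, Finset.sum_sub_distrib, ← Finset.mul_sum, hsum, harm]
    ring
  have hH : 0 < 1 + harm f m := by linarith
  have hd : 0 < a - c := by linarith
  constructor
  · rintro ⟨h0, h1, h2, h3⟩
    have h4 : ∀ j i, p.out j i = max (a - c - p.own) 0 / (((j : ℕ) : ℝ) + 1) := fun j =>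
      (hout p.own (p.out j)).1 ⟨h1 j, h3 j⟩
    simp only [hown, hexp _ _ h4] at h2
    have h5 := (isMax_quadratic_iff h0).1 h2
    have h6 : p.own < a - c := by
      by_contra! h7
      rw [max_eq_right (by linarith : a - c - p.own ≤ 0)] at h5
      rw [max_eq_left (by linarith)] at h5
      linarith
    have h7 : max (a - c - p.own) 0 = a - c - p.own := max_eq_left (by linarith)
    rw [h7] at h5
    have h8 : p.own = harm f m / (1 + harm f m) * (a - c) := by
      rcases le_total ((a - c - (a - c - p.own) * (1 - harm f m)) / 2) 0 with h9 | h9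
      · rw [max_eq_right h9] at h5
        rw [h5] at h9
        nlinarith
      · rw [max_eq_left h9] at h5
        field_simp
        linarith
    ext j i
    · exact h8
    · rw [h4, h7, h8]
      have : ((j : ℕ) : ℝ) + 1 ≠ 0 := by positivity
      field_simp
      ring
  · rintro rfl
    have hE : a - c - harm f m / (1 + harm f m) * (a - c) = (a - c) / (1 + harm f m) := by
      field_simp
      ring
    have hE0 : 0 < (a - c) / (1 + harm f m) := by positivity
    have h4 : ∀ (j : Fin (m + 1)) (_ : Fin (j : ℕ)),
        (a - c) / ((((j : ℕ) : ℝ) + 1) * (1 + harm f m)) =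
          max (a - c - harm f m / (1 + harm f m) * (a - c)) 0 / (((j : ℕ) : ℝ) + 1) := by
      intro j _
      rw [hE, max_eq_left hE0.le, div_div, mul_comm]
    have h5 := fun j : Fin (m + 1) => (hout (harm f m / (1 + harm f m) * (a - c))
      (fun _ : Fin (j : ℕ) => (a - c) / ((((j : ℕ) : ℝ) + 1) * (1 + harm f m)))).2 (h4 j)
    have hq : 0 ≤ harm f m / (1 + harm f m) * (a - c) := by positivity
    refine ⟨hq, fun j => (h5 j).1, ?_, fun j => (h5 j).2⟩
    simp only [hown, hexp _ _ h4]
    refine (isMax_quadratic_iff hq).2 ?_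
    rw [hE, max_eq_left hE0.le]
    have e : (a - c - (a - c) / (1 + harm f m) * (1 - harm f m)) / 2 =
        harm f m / (1 + harm f m) * (a - c) := by
      field_simp
      ring
    rw [e, max_eq_left hq]

/-- Existence and uniqueness of the equilibrium of the quantity game. -/
theorem isEquilibrium_belief_iff {a c : ℝ} (hca : c < a) (lam : ℝ) {m : ℕ} (p : Profile m) :
    IsEquilibrium a c (belief a c lam m) p ↔
      p = ⟨harm (belief a c lam m) m / (1 + harm (belief a c lam m) m) * (a - c),
        fun j _ => (a - c) / (((j : ℕ) + 1) * (1 + harm (belief a c lam m) m))⟩ :=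
  isEquilibrium_iff hca (belief_nonneg a c lam m) (sum_belief a c lam m) p

theorem equilibrium_eq {a c : ℝ} (hca : c < a) (lam : ℝ) (m : ℕ) :
    equilibrium a c lam m =
      ⟨harm (belief a c lam m) m / (1 + harm (belief a c lam m) m) * (a - c),
        fun j _ => (a - c) / (((j : ℕ) + 1) * (1 + harm (belief a c lam m) m))⟩ := by
  have h := Classical.epsilon_spec
    (p := fun p : Profile m => IsEquilibrium a c (belief a c lam m) p)
    ⟨_, (isEquilibrium_belief_iff hca lam _).2 rfl⟩
  exact (isEquilibrium_belief_iff hca lam _).1 h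

/-- Closed form of the characteristic function. -/
theorem value_eq {a c : ℝ} (hca : c < a) (lam : ℝ) {n : ℕ} {S : Finset (Fin n)} (hS : S ≠ ∅)
    {m : ℕ} (hm : n - S.card = m) {F : ℝ}
    (hF : F = ∑ j ∈ Finset.range (m + 1), (j * belief a c lam m j) / ((j : ℝ) + 1)) :
    value a c lam n S = (a - c) ^ 2 * ((1 - F) / (2 - F) ^ 2) *
      ∑ j ∈ Finset.range (m + 1), belief a c lam m j / ((j : ℝ) + 1) := by
  subst hm
  set m := n - S.card
  have hr : ∑ j ∈ Finset.range (m + 1), belief a c lam m j / ((j : ℝ) + 1) =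
      harm (belief a c lam m) m := by
    rw [harm, Fin.sum_univ_eq_sum_range (fun j => belief a c lam m j / ((j : ℝ) + 1))]
  have hs : ∑ j ∈ Finset.range (m + 1), belief a c lam m j = 1 := by
    rw [← Fin.sum_univ_eq_sum_range (fun j => belief a c lam m j), sum_belief]
  have hFh : F = 1 - harm (belief a c lam m) m := by
    rw [hF, ← hr]
    refine Eq.trans ?_ (congrArg (· - _) hs)
    rw [← Finset.sum_sub_distrib]
    refine Finset.sum_congr rfl fun j _ => ?_
    have : (j : ℝ) + 1 ≠ 0 := by positivity
    field_simp
    ring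
  have hh : 0 ≤ harm (belief a c lam m) m :=
    Finset.sum_nonneg fun j _ => div_nonneg (belief_nonneg ..) (by positivity)
  rw [value, if_neg hS, equilibrium_eq hca, hr, hFh]
  generalize hg : harm (belief a c lam m) m = h at hh
  have hh1 : 1 + h ≠ 0 := by positivity
  have hterm : ∀ j : Fin (m + 1), belief a c lam m j *
      ((a - h / (1 + h) * (a - c) -
        ∑ _i : Fin (j : ℕ), (a - c) / (((j : ℕ) + 1) * (1 + h)) - c) *
          (h / (1 + h) * (a - c))) =
      (a - c) ^ 2 * (h / (1 + h) ^ 2) * (belief a c lam m j / (((j : ℕ) : ℝ) + 1)) := by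
    intro j
    have : ((j : ℕ) : ℝ) + 1 ≠ 0 := by positivity
    simp only [Finset.sum_const, Finset.card_univ, Fintype.card_fin, nsmul_eq_mul]
    field_simp
    ring
  simp only [ownProfit]
  rw [Finset.sum_congr rfl fun j _ => hterm j, ← Finset.mul_sum]
  change _ * harm (belief a c lam m) m = _
  rw [hg]
  ring

end CournotGame

namespace CournotGame

/-! Write h for the expectation of 1 / (j + 1) against m outsiders. A coalition is then worth (a -
c)² (h / (1 + h))², and h = 1 when m = 0, so by symmetry the equal split is the natural core
candidate. It is in the core once 4 n h² ≤ (n - m) (1 + h)² for all m < n (`core_value_nonempty`).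
This is affine in n with nonnegative slope, so each m needs checking only at the smallest admissible
n. The demanding case is a single firm, n = m + 1, where h ≤ 1 / (2 √n) suffices.

The smallness of h comes from Bell numbers B. Under the uniform law, the Stirling recursion bounds
the mean of 1 / (j + 1) against m + 1 outsiders by 1 / r, with r = B (m + 1) / B m
(`stirlingSum_inv_succ_le`). Outsiders' profits lie between 0 and (a - c)² / 8, so logit weights
cost only a constant factor (`harm_belief_succ_le`). Log-convexity and the binomial recursion give
(1 + 1 / r) ^ m ≤ r (`one_add_inv_pow_le_bellRatio`). Its quadratic term alone forces r to grow at
least like m ^ (2 / 3), beating √m; this yields n₀.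

For the threshold 11, the same inequality gives r ≥ 2.27 √(m + 2) from m = 47 on
(`mul_sqrt_le_bellRatio`), and exact rational arithmetic settles 1 to 47 outsiders (`share_check`).
-/

/-! ### Sums weighted by Stirling numbers of the second kind -/

/-- `∑ j, S(m, j) φ(j)`, with `S(m, j)` the Stirling numbers of the second kind. -/
def stirlingSum {K : Type*} [CommSemiring K] (m : ℕ) (φ : ℕ → K) : K :=
  ∑ j ∈ Finset.range (m + 1), (Nat.stirlingSecond m j : K) * φ j

section CommSemiring

variable {K : Type*} [CommSemiring K]

lemma stirlingSum_zero (φ : ℕ → K) : stirlingSum 0 φ = φ 0 := by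
  simp [stirlingSum]

/-- A new element joins one of the j existing blocks or opens a block of its own. Moving the
recursion from the Stirling numbers onto φ lets later inductions run over arbitrary φ. -/
lemma stirlingSum_succ (m : ℕ) (φ : ℕ → K) :
    stirlingSum (m + 1) φ = stirlingSum m fun j => j * φ j + φ (j + 1) := by
  -- The shift costs nothing: k S(m, k) vanishes both at k = 0 and at k = m + 1.
  have hshift : ∑ k ∈ Finset.range (m + 1),
      (((k + 1 : ℕ) : K) * (Nat.stirlingSecond m (k + 1) : K)) * φ (k + 1) =
      ∑ k ∈ Finset.range (m + 1), ((k : K) * (Nat.stirlingSecond m k : K)) * φ k := by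
    have h := Finset.sum_range_succ'
      (fun k => ((k : K) * (Nat.stirlingSecond m k : K)) * φ k) (m + 1)
    rw [Finset.sum_range_succ, Nat.stirlingSecond_eq_zero_of_lt (Nat.lt_succ_self m)] at h
    simpa using h.symm
  simp only [stirlingSum]
  rw [Finset.sum_range_succ', Nat.stirlingSecond_succ_zero]
  simp only [Nat.stirlingSecond_succ_succ, Nat.cast_zero, zero_mul, add_zero, mul_add,
    Finset.sum_add_distrib]
  simp only [Nat.cast_add, Nat.cast_mul, add_mul, Finset.sum_add_distrib] at hshift ⊢
  rw [hshift]
  congr 1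
  exact Finset.sum_congr rfl fun k _ => by ring

lemma stirlingSum_add (m : ℕ) (φ ψ : ℕ → K) :
    stirlingSum m (fun j => φ j + ψ j) = stirlingSum m φ + stirlingSum m ψ := by
  simp only [stirlingSum, mul_add, Finset.sum_add_distrib]

lemma stirlingSum_mul_left (m : ℕ) (r : K) (φ : ℕ → K) :
    stirlingSum m (fun j => r * φ j) = r * stirlingSum m φ := by
  rw [stirlingSum, stirlingSum, Finset.mul_sum]
  exact Finset.sum_congr rfl fun k _ => by ring

/-- The binomial recursion, obtained by singling out the block of one element. -/
lemma stirlingSum_succ_eq_sum_choose (m : ℕ) (φ : ℕ → K) :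
    stirlingSum (m + 1) φ =
      ∑ i ∈ Finset.range (m + 1), (m.choose i : K) * stirlingSum i fun j => φ (j + 1) := by
  induction m generalizing φ with
  | zero => simp [stirlingSum_succ, stirlingSum_zero]
  | succ m ih =>
    -- Pascal's rule splits the right side into sums at levels i and i + 1; `stirlingSum_succ`
    -- lowers the latter to level i, where the summands agree.
    rw [stirlingSum_succ, ih,
      Finset.sum_choose_succ_mul (fun i _ => stirlingSum i fun j => φ (j + 1)),
      ← Finset.sum_add_distrib]
    refine Finset.sum_congr rfl fun i _ => ?_
    rw [← mul_add, stirlingSum_succ, ← stirlingSum_add]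
    congr 2
    funext j
    push_cast
    ring

end CommSemiring

lemma stirlingSum_mono (m : ℕ) {φ ψ : ℕ → ℝ} (h : ∀ j, φ j ≤ ψ j) :
    stirlingSum m φ ≤ stirlingSum m ψ :=
  Finset.sum_le_sum fun j _ => mul_le_mul_of_nonneg_left (h j) (Nat.cast_nonneg _)

lemma stirlingSum_nonneg (m : ℕ) {φ : ℕ → ℝ} (h : ∀ j, 0 ≤ φ j) : 0 ≤ stirlingSum m φ :=
  Finset.sum_nonneg fun j _ => mul_nonneg (Nat.cast_nonneg _) (h j)

lemma stirlingSum_pos (m : ℕ) {φ : ℕ → ℝ} (h : ∀ j, 0 < φ j) : 0 < stirlingSum m φ := by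
  refine Finset.sum_pos' (fun j _ => mul_nonneg (Nat.cast_nonneg _) (h j).le) ⟨m, by simp, ?_⟩
  simpa [Nat.stirlingSecond_self] using h m

/-! ### Growth of the Bell numbers -/

/-- The number of partitions of a set with `m` elements, as a real number. -/
def bellNumber (m : ℕ) : ℝ := stirlingSum m fun _ => 1

lemma bellNumber_pos (m : ℕ) : 0 < bellNumber m := stirlingSum_pos m fun _ => one_pos

lemma bellNumber_succ (m : ℕ) : bellNumber (m + 1) = stirlingSum m fun j => (j : ℝ) + 1 := by
  simp [bellNumber, stirlingSum_succ]

lemma bellNumber_succ_succ (m : ℕ) :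
    bellNumber (m + 2) = stirlingSum m fun j => ((j : ℝ) + 1) ^ 2 + 1 := by
  rw [bellNumber_succ, stirlingSum_succ]
  congr 1
  funext j
  push_cast
  ring

/-- For a uniform partition of m elements, E[j + 1] = r and E[(j + 1)²] + 1 = B (m + 2) / B m, so
this follows from the nonnegativity of the variance of j + 1. -/
lemma bellNumber_logConvex (m : ℕ) :
    bellNumber (m + 1) ^ 2 ≤ bellNumber m * bellNumber (m + 2) := by
  have hB := bellNumber_pos m
  set r := bellNumber (m + 1) / bellNumber m with hr
  have h : 0 ≤ stirlingSum m fun j => ((j : ℝ) + 1 - r) ^ 2 :=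
    stirlingSum_nonneg m fun j => sq_nonneg _
  have e : (fun j : ℕ => ((j : ℝ) + 1 - r) ^ 2) =
      fun j : ℕ => (((j : ℝ) + 1) ^ 2 + 1) + ((-2 * r) * ((j : ℝ) + 1) + (r ^ 2 - 1) * 1) := by
    funext j
    ring
  rw [e, stirlingSum_add m fun j : ℕ => ((j : ℝ) + 1) ^ 2 + 1,
    stirlingSum_add m fun j : ℕ => (-2 * r) * ((j : ℝ) + 1), stirlingSum_mul_left,
    stirlingSum_mul_left, ← bellNumber_succ_succ, ← bellNumber_succ] at h
  change 0 ≤ bellNumber (m + 2) + (-2 * r * bellNumber (m + 1) + (r ^ 2 - 1) * bellNumber m) at h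
  have h2 : bellNumber (m + 1) = r * bellNumber m := by rw [hr]; field_simp
  rw [h2] at h ⊢
  nlinarith

/-- The ratio of consecutive Bell numbers. -/
noncomputable def bellRatio (m : ℕ) : ℝ := bellNumber (m + 1) / bellNumber m

lemma bellRatio_pos (m : ℕ) : 0 < bellRatio m := div_pos (bellNumber_pos _) (bellNumber_pos _)

lemma bellRatio_monotone : Monotone bellRatio := by
  refine monotone_nat_of_le_succ fun m => ?_
  rw [bellRatio, bellRatio, div_le_div_iff₀ (bellNumber_pos _) (bellNumber_pos _)]
  linarith [bellNumber_logConvex m]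

/-- The quotient of the two Bell numbers telescopes into k consecutive ratios, all bounded by a
later one. -/
lemma bellNumber_le_pow_mul (m k : ℕ) :
    bellNumber (m + k) ≤ bellRatio (m + k) ^ k * bellNumber m := by
  induction k with
  | zero => simp
  | succ k ih =>
    have h1 : bellNumber (m + k + 1) = bellRatio (m + k) * bellNumber (m + k) := by
      rw [bellRatio]
      field_simp [(bellNumber_pos (m + k)).ne']
    have h2 : bellRatio (m + k) ≤ bellRatio (m + k + 1) := bellRatio_monotone (Nat.le_succ _)
    have h3 := bellRatio_pos (m + k)
    have h4 := bellNumber_pos m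
    rw [← add_assoc, h1]
    calc bellRatio (m + k) * bellNumber (m + k)
        ≤ bellRatio (m + k) * (bellRatio (m + k) ^ k * bellNumber m) := by gcongr
      _ = bellRatio (m + k) ^ (k + 1) * bellNumber m := by ring
      _ ≤ bellRatio (m + k + 1) ^ (k + 1) * bellNumber m := by gcongr

/-- Divide the binomial recursion for B (m + 1) by B m and bound B i / B m below by r ^ (-(m - i));
the binomial theorem sums the result. -/
lemma one_add_inv_pow_le_bellRatio (m : ℕ) : (1 + (bellRatio m)⁻¹) ^ m ≤ bellRatio m := by
  have hr := bellRatio_pos m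
  rw [show bellRatio m = bellNumber (m + 1) / bellNumber m from rfl] at hr ⊢
  rw [le_div_iff₀ (bellNumber_pos m), add_pow, Finset.sum_mul]
  conv_rhs => rw [bellNumber, stirlingSum_succ_eq_sum_choose]
  refine Finset.sum_le_sum fun i hi => ?_
  obtain ⟨k, rfl⟩ := Nat.exists_eq_add_of_le (Nat.lt_succ_iff.1 (Finset.mem_range.1 hi))
  have h := bellNumber_le_pow_mul i k
  rw [one_pow, one_mul, Nat.add_sub_cancel_left, mul_right_comm, mul_comm, inv_pow]
  refine mul_le_mul_of_nonneg_left ?_ (Nat.cast_nonneg ((i + k).choose i))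
  rw [inv_mul_le_iff₀ (pow_pos hr _)]
  exact h

/-- As R > 0 grows, (1 + 1 / R) ^ m does not increase, so a solution of R ≤ (1 + 1 / R) ^ m cannot
exceed r, which satisfies the reverse inequality. -/
lemma le_bellRatio {m : ℕ} {R : ℝ} (hR : R ≤ (1 + R⁻¹) ^ m) : R ≤ bellRatio m := by
  by_contra! h
  have hr := bellRatio_pos m
  have h1 : (1 + R⁻¹) ^ m ≤ (1 + (bellRatio m)⁻¹) ^ m := by
    have := hr.trans h
    gcongr
  linarith [one_add_inv_pow_le_bellRatio m]

lemma mul_le_two_mul_bellRatio_pow_three (m : ℕ) :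
    (m : ℝ) * (m - 1) ≤ 2 * bellRatio m ^ 3 := by
  have hr := bellRatio_pos m
  have h := one_add_inv_pow_le_bellRatio m
  have h2 : (m.choose 2 : ℝ) * (bellRatio m)⁻¹ ^ 2 ≤ (1 + (bellRatio m)⁻¹) ^ m := by
    rcases lt_or_ge m 2 with hm | hm
    · rw [Nat.choose_eq_zero_of_lt hm]
      simp only [Nat.cast_zero, zero_mul]
      positivity
    · rw [add_comm, add_pow]
      refine le_trans (le_of_eq ?_) (Finset.single_le_sum
        (f := fun i => (bellRatio m)⁻¹ ^ i * 1 ^ (m - i) * (m.choose i : ℝ))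
        (fun i _ => by positivity) (Finset.mem_range.2 (by omega : 2 < m + 1)))
      simp only [one_pow, mul_one]
      ring
  have h3 := h2.trans h
  rw [Nat.cast_choose_two, inv_pow, ← div_eq_mul_inv, div_le_iff₀ (by positivity)] at h3
  linarith [pow_succ (bellRatio m) 2, mul_comm (bellRatio m) (bellRatio m ^ 2)]

/-- The ratio of consecutive Bell numbers grows faster than the square root. -/
lemma eventually_mul_le_bellRatio_sq (K : ℝ) :
    ∃ M : ℕ, ∀ m : ℕ, M ≤ m → K * (m + 2) ≤ bellRatio m ^ 2 := by
  -- If r² < 2 |K| m, then r⁶ < 8 |K|³ m³, while r³ ≥ m² / 4 gives r⁶ ≥ m⁴ / 16; together m < 128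
  -- |K|³.
  obtain ⟨M, hM⟩ := exists_nat_ge (128 * |K| ^ 3)
  refine ⟨M + 2, fun m hm => ?_⟩
  by_contra! h
  have hr := bellRatio_pos m
  have hm2 : (M : ℝ) + 2 ≤ m := by exact_mod_cast hm
  have hM0 : (0 : ℝ) ≤ M := Nat.cast_nonneg M
  have hK : bellRatio m ^ 2 < |K| * (2 * m) := by
    refine h.trans_le (mul_le_mul (le_abs_self K) (by linarith) (by linarith) (abs_nonneg K))
  have h6 : (bellRatio m ^ 2) ^ 3 < (|K| * (2 * m)) ^ 3 :=
    pow_lt_pow_left₀ hK (by positivity) (by norm_num)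
  have hcube := mul_le_two_mul_bellRatio_pow_three m
  have hsq : (m : ℝ) ^ 2 / 4 ≤ bellRatio m ^ 3 := by nlinarith
  have h7 : ((m : ℝ) ^ 2 / 4) ^ 2 ≤ (bellRatio m ^ 3) ^ 2 :=
    pow_le_pow_left₀ (by positivity) hsq 2
  have h8 : (m : ℝ) ^ 3 * m ≤ (m : ℝ) ^ 3 * (128 * |K| ^ 3) := by
    have e1 : (bellRatio m ^ 3) ^ 2 = (bellRatio m ^ 2) ^ 3 := by ring
    have e2 : ((m : ℝ) ^ 2 / 4) ^ 2 = (m : ℝ) ^ 3 * m / 16 := by ring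
    have e3 : (|K| * (2 * m)) ^ 3 = (m : ℝ) ^ 3 * (128 * |K| ^ 3) / 16 := by ring
    rw [e1, e2] at h7
    rw [e3] at h6
    linarith
  have hm0 : (0 : ℝ) < m := by linarith
  have h9 := le_of_mul_le_mul_left h8 (by positivity)
  linarith

lemma exp_one_div_eight_le : Real.exp (1 / 8) ≤ 1.135 := by
  by_contra! h
  have h1 : (1.135 : ℝ) ^ 8 < Real.exp (1 / 8) ^ 8 :=
    pow_lt_pow_left₀ h (by norm_num) (by norm_num)
  rw [← Real.exp_nat_mul] at h1
  norm_num at h1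
  linarith [Real.exp_one_lt_d9]

/-- An explicit lower bound for the ratio of consecutive Bell numbers. -/
lemma mul_sqrt_le_bellRatio {m : ℕ} (hm : 47 ≤ m) :
    2.27 * √((m : ℝ) + 2) ≤ bellRatio m := by
  have hm' : (47 : ℝ) ≤ m := by exact_mod_cast hm
  set s := √((m : ℝ) + 2) with hs
  have hsq : s ^ 2 = m + 2 := Real.sq_sqrt (by linarith)
  have hs7 : 7 ≤ s := Real.le_sqrt_of_sq_le (by linarith)
  refine le_bellRatio ?_
  have hlog := Real.le_log_one_add_of_nonneg (x := (2.27 * s)⁻¹) (by positivity)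
  -- From log (1 + x) ≥ 2 x / (x + 2) the right side is at least 2 (s² - 2) / (4.54 s + 1), whose
  -- leading slope 2 / 4.54 exceeds 0.44.
  have h1 : 0.44 * s - 0.22 ≤ m * Real.log (1 + (2.27 * s)⁻¹) := by
    refine le_trans ?_ (mul_le_mul_of_nonneg_left hlog (by linarith))
    have e : (m : ℝ) * (2 * (2.27 * s)⁻¹ / ((2.27 * s)⁻¹ + 2)) = 2 * m / (4.54 * s + 1) := by
      field_simp
      ring
    rw [e, le_div_iff₀ (by positivity)]
    nlinarith
  have h2 : Real.exp (0.44 * s - 0.22) ≤ (1 + (2.27 * s)⁻¹) ^ m := by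
    rw [← Real.exp_log (show 0 < 1 + (2.27 * s)⁻¹ by positivity), ← Real.exp_nat_mul]
    exact Real.exp_le_exp.2 h1
  refine le_trans ?_ h2
  -- At s = 7 the exponent is 2.86 = 8 · 0.3575, and 16 just exceeds 2.27 · 7. Beyond s = 7 the
  -- tangent bound for exp outgrows 2.27 s.
  have h3 : (16 : ℝ) ≤ Real.exp 2.86 := by
    have h4 := Real.quadratic_le_exp_of_nonneg (x := 0.3575) (by norm_num)
    have h5 : (1.4214 : ℝ) ^ 8 ≤ Real.exp 0.3575 ^ 8 :=
      pow_le_pow_left₀ (by norm_num) (le_trans (by norm_num) h4) 8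
    rw [← Real.exp_nat_mul] at h5
    norm_num at h5 ⊢
    linarith
  have h6 : 0.44 * (s - 7) + 1 ≤ Real.exp (0.44 * (s - 7)) := Real.add_one_le_exp _
  have h7 : Real.exp (0.44 * s - 0.22) = Real.exp 2.86 * Real.exp (0.44 * (s - 7)) := by
    rw [← Real.exp_add]
    congr 1
    ring
  rw [h7]
  have h8 : 16 * (0.44 * (s - 7) + 1) ≤ Real.exp 2.86 * Real.exp (0.44 * (s - 7)) :=
    mul_le_mul h3 h6 (by linarith) (Real.exp_pos _).le
  linarith

/-- Averages of `1 / (j + 1)` under the uniform distribution on partitions. -/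
lemma stirlingSum_inv_succ_le (m : ℕ) :
    (stirlingSum (m + 1) fun j => ((j : ℝ) + 1)⁻¹) ≤ bellNumber m := by
  rw [stirlingSum_succ]
  refine stirlingSum_mono m fun j => ?_
  have hj : (0 : ℝ) ≤ j := Nat.cast_nonneg j
  -- The left side is what the recursion makes of 1 / (j + 1); it stays below 1.
  have e : (j : ℝ) * ((j : ℝ) + 1)⁻¹ + (((j + 1 : ℕ) : ℝ) + 1)⁻¹ =
      1 - (((j : ℝ) + 1) * (j + 2))⁻¹ := by
    push_cast
    field_simp
    ring
  rw [e]
  have : (0 : ℝ) ≤ (((j : ℝ) + 1) * (j + 2))⁻¹ := by positivity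
  linarith

/-! ### The core of the symmetric game -/

lemma value_eq_harm {a c : ℝ} (hca : c < a) (lam : ℝ) {n : ℕ} {S : Finset (Fin n)} (hS : S ≠ ∅) :
    value a c lam n S = (a - c) ^ 2 *
      (harm (belief a c lam (n - S.card)) (n - S.card) /
        (1 + harm (belief a c lam (n - S.card)) (n - S.card))) ^ 2 := by
  rw [value_eq hca lam hS rfl rfl]
  set m := n - S.card
  have hr : ∑ j ∈ Finset.range (m + 1), belief a c lam m j / ((j : ℝ) + 1) =
      harm (belief a c lam m) m := by
    rw [harm, Fin.sum_univ_eq_sum_range (fun j => belief a c lam m j / ((j : ℝ) + 1))]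
  have hs : ∑ j ∈ Finset.range (m + 1), belief a c lam m j = 1 := by
    rw [← Fin.sum_univ_eq_sum_range (fun j => belief a c lam m j), sum_belief]
  have hF : ∑ j ∈ Finset.range (m + 1), (j * belief a c lam m j) / ((j : ℝ) + 1) =
      1 - harm (belief a c lam m) m := by
    rw [eq_sub_iff_add_eq, ← hr, ← Finset.sum_add_distrib]
    refine Eq.trans ?_ hs
    refine Finset.sum_congr rfl fun j _ => ?_
    field_simp
  rw [hr, hF, div_pow]
  ring

lemma harm_belief_nonneg (a c lam : ℝ) (m : ℕ) : 0 ≤ harm (belief a c lam m) m :=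
  Finset.sum_nonneg fun j _ => div_nonneg (belief_nonneg ..) (by positivity)

lemma harm_belief_zero (a c lam : ℝ) : harm (belief a c lam 0) 0 = 1 := by
  have := sum_belief a c lam 0
  simpa [harm] using this

/-- For an equal split to be in the core it suffices that no coalition earns more per member than
the grand coalition does. -/
lemma core_value_nonempty {a c : ℝ} (hca : c < a) (lam : ℝ) {n : ℕ} (hn : 0 < n)
    (h : ∀ m < n, 4 * n * harm (belief a c lam m) m ^ 2 ≤
      (n - m) * (1 + harm (belief a c lam m) m) ^ 2) :
    (core (value a c lam n)).Nonempty := by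
  have hn' : (0 : ℝ) < n := by exact_mod_cast hn
  refine ⟨fun _ => (a - c) ^ 2 / (4 * n), ?_, fun S => ?_⟩
  · have hne : (Finset.univ : Finset (Fin n)) ≠ ∅ := by
      have : Nonempty (Fin n) := ⟨⟨0, hn⟩⟩
      exact Finset.univ_nonempty.ne_empty
    rw [value_eq_harm hca lam hne]
    simp only [Finset.card_univ, Fintype.card_fin, Nat.sub_self, harm_belief_zero, Finset.sum_const,
      nsmul_eq_mul]
    field_simp
    norm_num
  · rcases eq_or_ne S ∅ with rfl | hS
    · simp [value]
    · have hpos : 0 < S.card := Finset.card_pos.2 (Finset.nonempty_iff_ne_empty.2 hS)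
      have hle : S.card ≤ n := by simpa using S.card_le_univ
      have hm := h (n - S.card) (by omega)
      have hh := harm_belief_nonneg a c lam (n - S.card)
      rw [value_eq_harm hca lam hS]
      generalize harm (belief a c lam (n - S.card)) (n - S.card) = x at hm hh
      rw [Nat.cast_sub hle, sub_sub_cancel] at hm
      simp only [Finset.sum_const, nsmul_eq_mul]
      have hx : (x / (1 + x)) ^ 2 ≤ S.card / (4 * n) := by
        rw [div_pow, div_le_div_iff₀ (by positivity) (by positivity)]
        linarith
      calc (a - c) ^ 2 * (x / (1 + x)) ^ 2 ≤ (a - c) ^ 2 * (S.card / (4 * n)) := by gcongr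
        _ = S.card * ((a - c) ^ 2 / (4 * n)) := by ring

/-! ### Bounds for the expected share -/

lemma harm_belief_eq (a c lam : ℝ) (m : ℕ) :
    harm (belief a c lam m) m =
      (stirlingSum m fun j => Real.exp (lam * outsidersProfit a c j) * ((j : ℝ) + 1)⁻¹) /
        stirlingSum m fun j => Real.exp (lam * outsidersProfit a c j) := by
  have hw : ∑ i ∈ Finset.range (m + 1), weight a c lam m i =
      stirlingSum m fun j => Real.exp (lam * outsidersProfit a c j) :=
    Finset.sum_congr rfl fun j _ => mul_comm _ _
  rw [harm, Fin.sum_univ_eq_sum_range (fun j => belief a c lam m j / ((j : ℝ) + 1)),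
    stirlingSum, Finset.sum_div]
  refine Finset.sum_congr rfl fun j _ => ?_
  rw [belief, hw, weight]
  field_simp

lemma harm_belief_le_half (a c lam : ℝ) {m : ℕ} (hm : m ≠ 0) :
    harm (belief a c lam m) m ≤ 1 / 2 := by
  obtain ⟨k, rfl⟩ := Nat.exists_eq_succ_of_ne_zero hm
  rw [harm_belief_eq, div_le_iff₀ (stirlingSum_pos _ fun _ => Real.exp_pos _),
    ← stirlingSum_mul_left]
  refine Finset.sum_le_sum fun j _ => ?_
  rcases Nat.eq_zero_or_pos j with rfl | hj
  -- With an outsider present, j = 0 carries no weight; every other j has 1 / (j + 1) ≤ 1 / 2.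
  · simp [Nat.stirlingSecond_succ_zero]
  · refine mul_le_mul_of_nonneg_left ?_ (Nat.cast_nonneg _)
    beta_reduce
    rw [mul_comm (1 / 2 : ℝ)]
    refine mul_le_mul_of_nonneg_left ?_ (Real.exp_pos _).le
    rw [one_div]
    have : (1 : ℝ) ≤ j := by exact_mod_cast hj
    exact inv_anti₀ (by norm_num) (by linarith)

lemma outsidersProfit_nonneg {a c : ℝ} (hc : 0 < c) (hca : c < a) (j : ℕ) :
    0 ≤ outsidersProfit a c j := by
  rw [outsidersProfit_eq hc hca]
  positivity

/-- The quotient j / (j + 2)² peaks at j = 2, so the logit weights are bounded independently of m.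
-/
lemma outsidersProfit_le {a c : ℝ} (hc : 0 < c) (hca : c < a) (j : ℕ) :
    outsidersProfit a c j ≤ (a - c) ^ 2 / 8 := by
  rw [outsidersProfit_eq hc hca, div_pow, ← mul_div_assoc,
    div_le_div_iff₀ (by positivity) (by norm_num)]
  have : (8 : ℝ) * j ≤ (j + 2) ^ 2 := by nlinarith [sq_nonneg ((j : ℝ) - 2)]
  nlinarith [mul_le_mul_of_nonneg_left this (sq_nonneg (a - c))]

/-- The logit weights change the expected share by a bounded factor only. -/
lemma harm_belief_succ_le {a c lam : ℝ} (hc : 0 < c) (hca : c < a) (hlam0 : 0 ≤ lam) (m : ℕ) :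
    harm (belief a c lam (m + 1)) (m + 1) ≤ Real.exp (lam * ((a - c) ^ 2 / 8)) / bellRatio m := by
  have hB := bellNumber_pos (m + 1)
  have hnum : (stirlingSum (m + 1) fun j =>
      Real.exp (lam * outsidersProfit a c j) * ((j : ℝ) + 1)⁻¹) ≤
      Real.exp (lam * ((a - c) ^ 2 / 8)) * bellNumber m := by
    refine le_trans ?_ (mul_le_mul_of_nonneg_left (stirlingSum_inv_succ_le m) (Real.exp_pos _).le)
    rw [← stirlingSum_mul_left]
    refine stirlingSum_mono _ fun j => mul_le_mul_of_nonneg_right ?_ (by positivity)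
    exact Real.exp_le_exp.2 (mul_le_mul_of_nonneg_left (outsidersProfit_le hc hca j) hlam0)
  have hden : bellNumber (m + 1) ≤
      stirlingSum (m + 1) fun j => Real.exp (lam * outsidersProfit a c j) :=
    stirlingSum_mono _ fun j =>
      Real.one_le_exp (mul_nonneg hlam0 (outsidersProfit_nonneg hc hca j))
  rw [harm_belief_eq, bellRatio, div_div_eq_mul_div]
  exact div_le_div₀ (mul_nonneg (Real.exp_pos _).le (bellNumber_pos m).le) hnum hB hden

/-! ### The blocking inequality -/

/-- A coalition facing `m` outsiders does not block once there are at least `n₁` firms,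
if it does not block for `n₁`. -/
lemma nonblocking_mono {h : ℝ} (h0 : 0 ≤ h) (h1 : h ≤ 1) {n₁ n m : ℝ} (hn : n₁ ≤ n)
    (hb : 4 * n₁ * h ^ 2 ≤ (n₁ - m) * (1 + h) ^ 2) :
    4 * n * h ^ 2 ≤ (n - m) * (1 + h) ^ 2 := by
  have : 0 ≤ (n - n₁) * ((1 + h) ^ 2 - 4 * h ^ 2) :=
    mul_nonneg (sub_nonneg.2 hn) (by nlinarith)
  linarith

/-- Since h / (1 + h) increases with h, an upper bound for the expected share is enough. -/
lemma nonblocking_of_le {h t : ℝ} (h0 : 0 ≤ h) (ht : h ≤ t) {n m : ℝ} (hn : 0 ≤ n)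
    (hb : 4 * n * t ^ 2 ≤ (n - m) * (1 + t) ^ 2) :
    4 * n * h ^ 2 ≤ (n - m) * (1 + h) ^ 2 := by
  have ht0 := h0.trans ht
  have h2 : (h * (1 + t)) ^ 2 ≤ (t * (1 + h)) ^ 2 :=
    pow_le_pow_left₀ (by positivity) (by linarith) 2
  have h3 : 4 * n * (h * (1 + t)) ^ 2 ≤ 4 * n * (t * (1 + h)) ^ 2 := by gcongr
  have h4 := mul_le_mul_of_nonneg_right hb (sq_nonneg (1 + h))
  have h5 : 0 < (1 + t) ^ 2 := by positivity
  refine le_of_mul_le_mul_right ?_ h5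
  linarith

/-- The case of a lone firm against m + 1 outsiders: the hypothesis gives 4 (m + 2) h² ≤ 1 ≤ (1 +
h)². -/
lemma nonblocking_of_bellRatio {a c lam : ℝ} (hc : 0 < c) (hca : c < a) (hlam0 : 0 ≤ lam) {m : ℕ}
    (hm : 4 * Real.exp (lam * ((a - c) ^ 2 / 8)) ^ 2 * (m + 2) ≤ bellRatio m ^ 2) :
    4 * (((m + 1 : ℕ) : ℝ) + 1) * harm (belief a c lam (m + 1)) (m + 1) ^ 2 ≤
      (((m + 1 : ℕ) : ℝ) + 1 - (m + 1 : ℕ)) * (1 + harm (belief a c lam (m + 1)) (m + 1)) ^ 2 := by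
  have hr := bellRatio_pos m
  have h0 := harm_belief_nonneg a c lam (m + 1)
  have h1 := harm_belief_succ_le hc hca hlam0 m
  generalize harm (belief a c lam (m + 1)) (m + 1) = h at h0 h1
  have h2 : h ^ 2 ≤ (Real.exp (lam * ((a - c) ^ 2 / 8)) / bellRatio m) ^ 2 :=
    pow_le_pow_left₀ h0 h1 2
  have h3 : 4 * ((m : ℝ) + 2) * (Real.exp (lam * ((a - c) ^ 2 / 8)) / bellRatio m) ^ 2 ≤ 1 := by
    rw [div_pow, ← mul_div_assoc, div_le_one (by positivity)]
    linarith
  have h4 : 4 * ((m : ℝ) + 2) * h ^ 2 ≤ 1 := le_trans (by gcongr) h3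
  push_cast
  nlinarith

theorem exists_forall_core_nonempty {a c lam : ℝ} (hc : 0 < c) (hca : c < a) (hlam0 : 0 ≤ lam) :
    ∃ n₀ : ℕ, ∀ n : ℕ, n₀ ≤ n → (core (value a c lam n)).Nonempty := by
  obtain ⟨M, hM⟩ := eventually_mul_le_bellRatio_sq (4 * Real.exp (lam * ((a - c) ^ 2 / 8)) ^ 2)
  refine ⟨2 * M + 2, fun n hn => core_value_nonempty hca lam (by omega) fun m hmn => ?_⟩
  rcases m with _ | m
  · rw [harm_belief_zero]
    push_cast
    linarith
  · have h0 := harm_belief_nonneg a c lam (m + 1)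
    have h1 := harm_belief_le_half a c lam (Nat.succ_ne_zero m)
    rcases le_or_gt M m with h | h
    · refine nonblocking_mono h0 (by linarith) ?_ (nonblocking_of_bellRatio hc hca hlam0 (hM m h))
      exact_mod_cast hmn
    -- With few outsiders the coalition holds at least half of the firms, and h ≤ 1 / 2 suffices: n
    -- ≤ (n / 2) (9 / 4).
    · refine nonblocking_of_le h0 h1 (Nat.cast_nonneg n) ?_
      have : (2 : ℝ) * (m + 1 : ℕ) ≤ n := by exact_mod_cast (by omega : 2 * (m + 1) ≤ n)
      linarith

/-! ### Explicit evaluation for a small number of outsiders -/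

/-- From the entries `k, k + 1, …` of a row of the Stirling triangle, the entries
`k, k + 1, …` of the next row; `prev` is the entry `k - 1`. -/
def stirlingStep : ℕ → ℕ → List ℕ → List ℕ
  | _, prev, [] => [prev]
  | k, prev, x :: xs => (k * x + prev) :: stirlingStep (k + 1) x xs

/-- The rows of the triangle of Stirling numbers of the second kind. -/
def stirlingRow : ℕ → List ℕ
  | 0 => [1]
  | m + 1 => stirlingStep 0 0 (stirlingRow m)

/-- `∑ i, l[i] * φ (k + i)`. -/
def weightedSum (φ : ℕ → ℚ) : ℕ → List ℕ → ℚ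
  | _, [] => 0
  | k, x :: xs => x * φ k + weightedSum φ (k + 1) xs

lemma weightedSum_stirlingStep (φ : ℕ → ℚ) (l : List ℕ) (k prev : ℕ) :
    weightedSum φ k (stirlingStep k prev l) =
      prev * φ k + weightedSum (fun j => j * φ j + φ (j + 1)) k l := by
  induction l generalizing k prev with
  | nil => simp [stirlingStep, weightedSum]
  | cons x xs ih =>
    rw [stirlingStep, weightedSum, ih, weightedSum]
    push_cast
    ring

/-- Both sides obey the recursion of `stirlingSum_succ`. This links the list computation, which the
kernel can evaluate, to the sums in the estimates. -/
lemma weightedSum_stirlingRow (φ : ℕ → ℚ) (m : ℕ) :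
    weightedSum φ 0 (stirlingRow m) = stirlingSum m φ := by
  induction m generalizing φ with
  | zero => simp [stirlingRow, weightedSum, stirlingSum_zero]
  | succ m ih => rw [stirlingRow, weightedSum_stirlingStep, ih, stirlingSum_succ]; simp

lemma cast_stirlingSum (m : ℕ) (φ : ℕ → ℚ) :
    ((stirlingSum m φ : ℚ) : ℝ) = stirlingSum m fun j => (φ j : ℝ) := by
  simp [stirlingSum]

/-- Quadratic lower bound for `exp (l j / (j + 2) ^ 2)`. -/
def lowerWeight (l j : ℕ) : ℚ :=
  1 + (l * j / (j + 2) ^ 2 : ℚ) + (l * j / (j + 2) ^ 2 : ℚ) ^ 2 / 2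

/-- Cubic upper bound for `exp (l j / (j + 2) ^ 2)`. -/
def upperWeight (l j : ℕ) : ℚ :=
  lowerWeight l j + (l * j / (j + 2) ^ 2 : ℚ) ^ 3 * 2 / 9

/-- The numerator of an upper bound for the expected share against `m` outsiders. -/
def shareNum (l m : ℕ) : ℚ :=
  weightedSum (fun j => upperWeight l j * (j + 1 : ℚ)⁻¹) 0 (stirlingRow m)

/-- The denominator of an upper bound for the expected share against `m` outsiders. -/
def shareDen (l m : ℕ) : ℚ := weightedSum (lowerWeight l) 0 (stirlingRow m)

/-- Coalitions facing between `1` and `47` outsiders do not block when there are at least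
eleven firms. -/
lemma share_check : ∀ l < 2, ∀ m < 48, 1 ≤ m →
    4 * (max 11 (m + 1) : ℕ) * shareNum l m ^ 2 ≤
      ((max 11 (m + 1) : ℕ) - (m : ℚ)) * (shareDen l m + shareNum l m) ^ 2 := by
  decide +kernel

lemma weight_bounds (l j : ℕ) (hl : l < 2) :
    (lowerWeight l j : ℝ) ≤ Real.exp (l * (j / ((j : ℝ) + 2) ^ 2)) ∧
      Real.exp (l * (j / ((j : ℝ) + 2) ^ 2)) ≤ upperWeight l j := by
  set x : ℝ := l * (j / ((j : ℝ) + 2) ^ 2) with hx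
  have hx0 : 0 ≤ x := by positivity
  have hl1 : (l : ℝ) ≤ 1 := by exact_mod_cast Nat.lt_succ_iff.1 hl
  have hx1 : x ≤ 1 := by
    refine mul_le_one₀ hl1 (by positivity) ?_
    rw [div_le_one (by positivity)]
    nlinarith [(Nat.cast_nonneg j : (0 : ℝ) ≤ j)]
  have hlow : (lowerWeight l j : ℝ) = 1 + x + x ^ 2 / 2 := by
    rw [lowerWeight, hx]
    push_cast
    ring
  have hupp : (upperWeight l j : ℝ) = 1 + x + x ^ 2 / 2 + x ^ 3 * 2 / 9 := by
    rw [upperWeight, Rat.cast_add, hlow, hx]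
    push_cast
    ring
  refine ⟨hlow ▸ Real.quadratic_le_exp_of_nonneg hx0, ?_⟩
  -- The remainder x³ · 4 / (3! · 3) is the source of the 2 / 9 in `upperWeight`.
  have h := Real.exp_bound' hx0 hx1 (n := 3) (by norm_num)
  rw [hupp]
  refine h.trans (le_of_eq ?_)
  norm_num [Finset.sum_range_succ, Nat.factorial]
  ring

/-- The computed bound dominates the expected share in the uniform model (`l = 0`) and in the
logit model with `a - c = 1` (`l = 1`). -/
lemma harm_belief_le_share {a c lam : ℝ} (hc : 0 < c) (hca : c < a) {l : ℕ} (hl : l < 2)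
    (hlam : lam * (a - c) ^ 2 = l) (m : ℕ) :
    0 < (shareDen l m : ℝ) ∧
      harm (belief a c lam m) m ≤ (shareNum l m : ℝ) / (shareDen l m : ℝ) := by
  have hexp : ∀ j : ℕ, lam * outsidersProfit a c j = l * (j / ((j : ℝ) + 2) ^ 2) := by
    intro j
    rw [outsidersProfit_eq hc hca, ← hlam, div_pow]
    ring
  have hden : (shareDen l m : ℝ) = stirlingSum m fun j => (lowerWeight l j : ℝ) := by
    rw [shareDen, weightedSum_stirlingRow, cast_stirlingSum]
  have hnum : (shareNum l m : ℝ) =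
      stirlingSum m fun j => (upperWeight l j : ℝ) * ((j : ℝ) + 1)⁻¹ := by
    rw [shareNum, weightedSum_stirlingRow, cast_stirlingSum]
    push_cast
    rfl
  have hpos : 0 < (shareDen l m : ℝ) := by
    rw [hden]
    refine stirlingSum_pos m fun j => ?_
    rw [Rat.cast_pos, lowerWeight]
    positivity
  refine ⟨hpos, ?_⟩
  rw [harm_belief_eq]
  simp only [hexp]
  have hn : (stirlingSum m fun j => Real.exp (l * (j / ((j : ℝ) + 2) ^ 2)) * ((j : ℝ) + 1)⁻¹) ≤
      shareNum l m := by
    rw [hnum]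
    exact stirlingSum_mono m fun j =>
      mul_le_mul_of_nonneg_right (weight_bounds l j hl).2 (by positivity)
  refine div_le_div₀ ?_ hn hpos ?_
  · exact le_trans (stirlingSum_nonneg m fun j => by positivity) hn
  · rw [hden]
    exact stirlingSum_mono m fun j => (weight_bounds l j hl).1

/-- The number max 11 (m + 1) is the least n with n ≥ 11 and m < n; `share_check` is this inequality
for the rational bound, with denominators cleared. -/
lemma nonblocking_of_lt {a c lam : ℝ} (hc : 0 < c) (hca : c < a) {l : ℕ} (hl : l < 2)
    (hlam : lam * (a - c) ^ 2 = l) {m : ℕ} (hm : m < 48) (hm1 : 1 ≤ m) :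
    4 * ((max 11 (m + 1) : ℕ) : ℝ) * harm (belief a c lam m) m ^ 2 ≤
      (((max 11 (m + 1) : ℕ) : ℝ) - m) * (1 + harm (belief a c lam m) m) ^ 2 := by
  obtain ⟨hpos, hle⟩ := harm_belief_le_share hc hca hl hlam m
  refine nonblocking_of_le (harm_belief_nonneg a c lam m) hle (Nat.cast_nonneg _) ?_
  have h : (4 * ((max 11 (m + 1) : ℕ) : ℝ) * (shareNum l m : ℝ) ^ 2) ≤
      (((max 11 (m + 1) : ℕ) : ℝ) - m) * ((shareDen l m : ℝ) + (shareNum l m : ℝ)) ^ 2 := by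
    exact_mod_cast share_check l hl m hm hm1
  have e : 1 + (shareNum l m : ℝ) / shareDen l m =
      ((shareDen l m : ℝ) + shareNum l m) / shareDen l m := by
    field_simp
  rw [e, div_pow, div_pow, ← mul_div_assoc, ← mul_div_assoc]
  exact div_le_div_of_nonneg_right h (sq_nonneg _)

/-! ### Eleven or more firms -/

/-- The bound for many outsiders, when the logit weights are at most `exp (1 / 8)`. -/
lemma four_mul_exp_sq_mul_le_bellRatio_sq {m : ℕ} (hm : 47 ≤ m) {x : ℝ} (hx : x ≤ 1 / 8) :
    4 * Real.exp x ^ 2 * (m + 2) ≤ bellRatio m ^ 2 := by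
  have h1 : (2.27 * √((m : ℝ) + 2)) ^ 2 ≤ bellRatio m ^ 2 :=
    pow_le_pow_left₀ (by positivity) (mul_sqrt_le_bellRatio hm) 2
  rw [mul_pow, Real.sq_sqrt (by positivity)] at h1
  have h2 : Real.exp x ^ 2 ≤ 1.135 ^ 2 := by
    refine pow_le_pow_left₀ (Real.exp_pos x).le ?_ 2
    exact (Real.exp_le_exp.2 hx).trans exp_one_div_eight_le
  refine le_trans (mul_le_mul_of_nonneg_right ?_ (by positivity)) h1
  -- The constants match: 2.27 = 2 · 1.135.
  linarith

theorem core_nonempty_of_eleven_le {a c lam : ℝ} (hc : 0 < c) (hca : c < a) (hlam0 : 0 ≤ lam)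
    {l : ℕ} (hl : l < 2) (hlam : lam * (a - c) ^ 2 = l) {n : ℕ} (hn : 11 ≤ n) :
    (core (value a c lam n)).Nonempty := by
  refine core_value_nonempty hca lam (by omega) fun m hmn => ?_
  rcases m with _ | m
  · rw [harm_belief_zero]
    push_cast
    linarith
  · have h0 := harm_belief_nonneg a c lam (m + 1)
    have h1 := harm_belief_le_half a c lam (Nat.succ_ne_zero m)
    -- There are m + 1 outsiders here, so the finite check covers exactly the cases below the range
    -- of `mul_sqrt_le_bellRatio`.
    rcases lt_or_ge m 47 with h | h
    · refine nonblocking_mono h0 (by linarith) ?_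
        (nonblocking_of_lt hc hca hl hlam (by omega : m + 1 < 48) (by omega))
      exact_mod_cast max_le hn hmn
    · have hl1 : (l : ℝ) ≤ 1 := by exact_mod_cast Nat.lt_succ_iff.1 hl
      refine nonblocking_mono h0 (by linarith) ?_ (nonblocking_of_bellRatio hc hca hlam0
        (four_mul_exp_sq_mul_le_bellRatio_sq h (by linarith)))
      exact_mod_cast hmn

end CournotGame

theorem proposition1 (a c lam : ℝ) (hc : 0 < c) (hca : c < a) (hlam : lam = 0 ∨ lam = 1) :
    (∃ n₀ : ℕ, ∀ n : ℕ, n₀ ≤ n → (CournotGame.core (CournotGame.value a c lam n)).Nonempty) ∧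
    (lam = 0 ∨ a - c = 1 →
      ∀ n : ℕ, 11 ≤ n → (CournotGame.core (CournotGame.value a c lam n)).Nonempty) := by
  have hlam0 : 0 ≤ lam := by rcases hlam with rfl | rfl <;> norm_num
  refine ⟨CournotGame.exists_forall_core_nonempty hc hca hlam0, fun h n hn => ?_⟩
  rcases hlam with rfl | rfl
  · exact CournotGame.core_nonempty_of_eleven_le hc hca hlam0 (l := 0) (by norm_num) (by simp) hn
  · have hd : a - c = 1 := h.resolve_left one_ne_zero
    exact CournotGame.core_nonempty_of_eleven_le hc hca hlam0 (l := 1) (by norm_num)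
      (by simp [hd]) hn
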